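/- Let $\mathbf{k}$ be a field of characteristic $0$ and let $(\mathfrak g,[\,,\,],\alpha)$ be a (multiplicative) Hom-Lie algebra over $\mathbf{k}$: a vector space with a skew-symmetric bilinear bracket and a linear map $\alpha$ such that $[\alpha(x),[y,z]]+[\alpha(y),[z,x]]+[\alpha(z),[x,y]]=0$ and $\alpha([x,y])=[\alpha(x),\alpha(y)]$ for all $x,y,z\in\mathfrak g$. For $n\ge 1$ let $C^n=C^n_{\mathrm{Hom}}(\mathfrak g,\mathfrak g)$ be the space of skew-symmetric $n$-linear maps $f:\mathfrak g^n\to\mathfrak g$ with $\alpha(f(x_1,\dots,x_n))=f(\alpha(x_1),\dots,\alpha(x_n))$. For $f\in C^n$, $P\in C^m$, $Q\in C^n$ ($m,n\ge 1$), let $\delta_{\mathrm{Hom}}f\in C^{n+1}$, $i_PQ\in C^{m+n-1}$, $[P,Q]_{\mathsf C}\in C^{m+n}$ and the Frölicher–Nijenhuis bracket $[P,Q]_{\mathsf{FN}}\in C^{m+n}$ be given by $$(\delta_{\mathrm{Hom}}f)(x_1,\dots,x_{n+1})=\sum_{i}(-1)^{i+1}[\alpha^{n-1}(x_i),f(\dots,\widehat{x_i},\dots)]+\sum_{i<j}(-1)^{i+j}f([x_i,x_j],\alpha(x_1),\dots,\widehat{\alpha(x_i)},\dots,\widehat{\alpha(x_j)},\dots,\alpha(x_{n+1})),$$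 $$(i_PQ)(x_1,\dots,x_{m+n-1})=\sum_{\sigma\in Sh(m,n-1)}(-1)^\sigma\,Q\big(P(x_{\sigma(1)},\dots,x_{\sigma(m)}),\alpha^{m-1}x_{\sigma(m+1)},\dots,\alpha^{m-1}x_{\sigma(m+n-1)}\big),$$ $$[P,Q]_{\mathsf C}(x_1,\dots,x_{m+n})=\sum_{\sigma\in Sh(m,n)}(-1)^\sigma[\alpha^{n-1}P(x_{\sigma(1)},\dots,x_{\sigma(m)}),\alpha^{m-1}Q(x_{\sigma(m+1)},\dots,x_{\sigma(m+n)})],$$ $$[P,Q]_{\mathsf{FN}}=[P,Q]_{\mathsf C}+(-1)^m\,i_{(\delta_{\mathrm{Hom}}P)}Q-(-1)^{(m+1)n}\,i_{(\delta_{\mathrm{Hom}}Q)}P,$$ where $Sh(m,n)$ is the set of $(m,n)$-shuffles. For a linear map $N:\mathfrak g\to\mathfrak g$ put $[x,y]^N=[Nx,y]+[x,Ny]-N[x,y]$. Call $N$ a Nijenhuis operator if $\alpha\circ N=N\circ\alpha$ and $[Nx,Ny]=N([x,y]^N)$ for all $x,y\in\mathfrak g$. A Maurer–Cartan element of the Frölicher–Nijenhuis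 algebra $(\bigoplus_{n\ge1}C^n,[\,,\,]_{\mathsf{FN}})$ (with zero differential) is an $s\in C^1$ with $\tfrac12[s,s]_{\mathsf{FN}}=0$. Let $N:\mathfrak g\to\mathfrak g$ be a linear map with $\alpha\circ N=N\circ\alpha$, regarded as an element of $C^1$. Then: 1. $(\mathfrak g,[\,,\,]^N,\alpha)$ is a (multiplicative) Hom-Lie algebra if and only if $\delta_{\mathrm{Hom}}([N,N]_{\mathsf{FN}})=0$. 2. $[N,N]_{\mathsf{FN}}(x,y)=2\big([Nx,Ny]-N([x,y]^N)\big)$ for all $x,y\in\mathfrak g$. 3. $N$ is a Nijenhuis operator if and only if $[N,N]_{\mathsf{FN}}=0$. Consequently, the Nijenhuis operators on $(\mathfrak g,[\,,\,],\alpha)$ are exactly the Maurer–Cartan elements of the Frölicher–Nijenhuis algebra: a linear map $N:\mathfrak g\to\mathfrak g$ is a Nijenhuis operator if and only if it commutes with $\alpha$ and, as an element of $C^1$, is a Maurer–Cartan element; and every Maurer–Cartan element is given by a Nijenhuis operator. -/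

import Mathlib

/-- A (multiplicative) Hom-Lie algebra structure on the vector space `g`, with bracket `μ` and
twist map `α`: the bracket is bilinear and skew-symmetric, satisfies the Hom-Jacobi identity,
and `α` preserves it. -/
structure IsHomLieAlgebra {k g : Type*} [Field k] [AddCommGroup g] [Module k g]
    (μ : g →ₗ[k] g →ₗ[k] g) (α : g →ₗ[k] g) : Prop where
  skew : ∀ x y, μ x y = -μ y x
  hom_jacobi : ∀ x y z, μ (α x) (μ y z) + μ (α y) (μ z x) + μ (α z) (μ x y) = 0
  multiplicative : ∀ x y, α (μ x y) = μ (α x) (α y)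

namespace HomLie

open TensorProduct

section Shuffles

/-- The set `Sh(m, n)` of `(m, n)`-shuffles: permutations that are increasing on the first `m`
and on the last `n` indices. -/
def shuffles (m n : ℕ) : Finset (Equiv.Perm (Fin (m + n))) :=
  {σ | StrictMono (fun i : Fin m => σ (Fin.castAdd n i)) ∧
    StrictMono (fun j : Fin n => σ (Fin.natAdd m j))}

theorem strictMono_eq_of_perm {m : ℕ} {β : Type*} [LinearOrder β] {f f' : Fin m → β}
    (hf : StrictMono f) (hf' : StrictMono f') (s : Equiv.Perm (Fin m)) (h : ∀ i, f' i = f (s i)) :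
    f' = f := by
  refine (hf'.range_inj hf).1 ?_
  have : f' = f ∘ s := funext h
  rw [this, s.surjective.range_comp]

theorem exists_sort {m : ℕ} {β : Type*} [LinearOrder β] {f : Fin m → β}
    (hf : Function.Injective f) : ∃ s : Equiv.Perm (Fin m), StrictMono (fun i => f (s i)) :=
  ⟨Tuple.sort f, (Tuple.monotone_sort f).strictMono_of_injective
    (hf.comp (Tuple.sort f).injective)⟩

variable {k g V W : Type*} [Field k] [AddCommGroup g] [Module k g]
  [AddCommGroup V] [Module k V] [AddCommGroup W] [Module k W]

theorem domCoprod_eq_sum_shuffles {m n : ℕ} (a : g [⋀^Fin m]→ₗ[k] V) (b : g [⋀^Fin n]→ₗ[k] W)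
    (x : Fin (m + n) → g) :
    (a.domCoprod b).domDomCongr finSumFinEquiv x =
      ∑ σ ∈ shuffles m n, (Equiv.Perm.sign σ : ℤ) •
        (a (fun i => x (σ (Fin.castAdd n i))) ⊗ₜ[k] b (fun j => x (σ (Fin.natAdd m j)))) := by
  classical
  rw [AlternatingMap.domDomCongr_apply, AlternatingMap.domCoprod_apply,
    sum_apply]
  symm
  refine Finset.sum_bij
    (fun σ _ => (Quotient.mk'' (finSumFinEquiv.symm.permCongr σ) :
      Equiv.Perm.ModSumCongr (Fin m) (Fin n))) (fun _ _ => Finset.mem_univ _) ?_ ?_ ?_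
  · intro σ hσ τ hτ h
    simp only [shuffles, Finset.mem_filter, Finset.mem_univ, true_and] at hσ hτ
    have h' := QuotientGroup.leftRel_apply.mp (Quotient.exact' h)
    obtain ⟨⟨s, t⟩, hst⟩ := h'
    have hst := (inv_mul_eq_iff_eq_mul.mp hst.symm)
    have e1 : ∀ i, τ (Fin.castAdd n i) = σ (Fin.castAdd n (s i)) := by
      intro i
      have := congrArg finSumFinEquiv (Equiv.congr_fun hst (Sum.inl i))
      simpa [Equiv.permCongr_apply] using this
    have e2 : ∀ i, τ (Fin.natAdd m i) = σ (Fin.natAdd m (t i)) := by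
      intro i
      have := congrArg finSumFinEquiv (Equiv.congr_fun hst (Sum.inr i))
      simpa [Equiv.permCongr_apply] using this
    have f1 := strictMono_eq_of_perm hσ.1 hτ.1 s e1
    have f2 := strictMono_eq_of_perm hσ.2 hτ.2 t e2
    ext i
    induction i using Fin.addCases with
    | left i => rw [congrFun f1 i]
    | right i => rw [congrFun f2 i]
  · intro q _
    induction q using Quotient.inductionOn' with | _ ρ
    obtain ⟨s, hs⟩ := exists_sort (f := fun i : Fin m => finSumFinEquiv (ρ (Sum.inl i)))
      (finSumFinEquiv.injective.comp (ρ.injective.comp Sum.inl_injective))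
    obtain ⟨t, ht⟩ := exists_sort (f := fun i : Fin n => finSumFinEquiv (ρ (Sum.inr i)))
      (finSumFinEquiv.injective.comp (ρ.injective.comp Sum.inr_injective))
    refine ⟨finSumFinEquiv.permCongr (ρ * Equiv.Perm.sumCongrHom _ _ (s, t)), ?_, ?_⟩
    · simp only [shuffles, Finset.mem_filter, Finset.mem_univ, true_and]
      constructor
      · simpa [Equiv.permCongr_apply] using hs
      · simpa [Equiv.permCongr_apply] using ht
    · refine Quotient.sound' (QuotientGroup.leftRel_apply.mpr ⟨(s⁻¹, t⁻¹), ?_⟩)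
      have : finSumFinEquiv.symm.permCongr
          (finSumFinEquiv.permCongr (ρ * Equiv.Perm.sumCongrHom _ _ (s, t))) =
          ρ * Equiv.Perm.sumCongrHom _ _ (s, t) := by
        ext i; simp [Equiv.permCongr_apply]
      rw [this, mul_inv_rev, inv_mul_cancel_right, ← map_inv]
      rfl
  · intro σ _
    rw [AlternatingMap.domCoprod.summand_mk'']
    rw [_root_.smul_apply, Units.smul_def, MultilinearMap.domDomCongr_apply,
      MultilinearMap.domCoprod_apply]
    simp [Equiv.permCongr_apply]

end Shuffles

variable {k g : Type*} [Field k] [AddCommGroup g] [Module k g]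

/-- `C^n_Hom(g, g)` for `n ≥ 1`: skew-symmetric `n`-linear maps commuting with `α`. -/
def cochain (α : g →ₗ[k] g) (n : ℕ) : Submodule k (g [⋀^Fin n]→ₗ[k] g) where
  carrier := {f | ∀ x : Fin n → g, α (f x) = f (fun i => α (x i))}
  add_mem' hf hf' x := by simp [hf x, hf' x]
  zero_mem' x := by simp
  smul_mem' c f hf x := by simp [hf x]

variable {α : g →ₗ[k] g} {μ : g →ₗ[k] g →ₗ[k] g}

theorem cochain_map {n : ℕ} (f : cochain α n) (x : Fin n → g) :
    α (f.1 x) = f.1 (fun i => α (x i)) := f.2 x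

theorem cochain_map_pow {n : ℕ} (f : cochain α n) (x : Fin n → g) (r : ℕ) :
    (α ^ r) (f.1 x) = f.1 (fun i => (α ^ r) (x i)) := by
  induction r with
  | zero => simp
  | succ r ih => simp only [pow_succ', Module.End.mul_apply, ih, cochain_map]

theorem pow_comm_apply (α : g →ₗ[k] g) (r : ℕ) (x : g) : (α ^ r) (α x) = α ((α ^ r) x) := by
  rw [← Module.End.mul_apply, ← Module.End.mul_apply, ← pow_succ, ← pow_succ']

theorem bracket_map_pow (h : IsHomLieAlgebra μ α) (r : ℕ) (x y : g) :
    (α ^ r) (μ x y) = μ ((α ^ r) x) ((α ^ r) y) := by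
  induction r with
  | zero => simp
  | succ r ih => simp only [pow_succ', Module.End.mul_apply, ih, h.multiplicative]

/-- Reindexing of cochains along an equality of degrees. -/
def cochain.cast {m n : ℕ} (e : m = n) (f : cochain α m) : cochain α n := e ▸ f

/-- A linear map commuting with `α`, seen as an element of `C^1_Hom(g, g)`. -/
def ofLinear (N : g →ₗ[k] g) (hN : α ∘ₗ N = N ∘ₗ α) : cochain α 1 :=
  ⟨AlternatingMap.ofSubsingleton k g g 0 N, fun x => by
    simpa using LinearMap.congr_fun hN (x 0)⟩

section Contraction

/-- Auxiliary: the map `y ↦ (p ↦ Q (p, α^r y₁, …, α^r yₙ))`. -/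
def tailMap (r : ℕ) {n : ℕ} (α : g →ₗ[k] g) (Q : g [⋀^Fin (n + 1)]→ₗ[k] g) :
    g [⋀^Fin n]→ₗ[k] (g →ₗ[k] g) where
  toFun y :=
    { toFun := fun p => Q (Fin.cons p (fun j => (α ^ r) (y j)))
      map_add' := fun p q => by
        simpa using Q.toMultilinearMap.cons_add (fun j => (α ^ r) (y j)) p q
      map_smul' := fun c p => by
        simpa using Q.toMultilinearMap.cons_smul (fun j => (α ^ r) (y j)) c p }
  map_update_add' y i p q := by
    ext z
    exact ((Q.curryLeft z).compLinearMap (α ^ r)).toMultilinearMap.map_update_add y i p q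
  map_update_smul' y i c p := by
    ext z
    exact ((Q.curryLeft z).compLinearMap (α ^ r)).toMultilinearMap.map_update_smul y i c p
  map_eq_zero_of_eq' y i j hy hij := by
    ext z
    exact ((Q.curryLeft z).compLinearMap (α ^ r)).map_eq_zero_of_eq y hy hij

theorem contraction_aux {m n : ℕ} (P : g [⋀^Fin (m + 1)]→ₗ[k] g) (Q : g [⋀^Fin (n + 1)]→ₗ[k] g)
    (x : Fin (m + 1 + n) → g) :
    (TensorProduct.lift (LinearMap.id.flip)).compAlternatingMap
      ((P.domCoprod (tailMap m α Q)).domDomCongr finSumFinEquiv) x =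
    ∑ σ ∈ shuffles (m + 1) n, (Equiv.Perm.sign σ : ℤ) •
      Q (Fin.cons (P (fun i => x (σ (Fin.castAdd n i))))
        (fun j => (α ^ m) (x (σ (Fin.natAdd (m + 1) j))))) := by
  rw [LinearMap.compAlternatingMap_apply, domCoprod_eq_sum_shuffles, map_sum]
  refine Finset.sum_congr rfl fun σ _ => ?_
  rw [map_zsmul]
  rfl

/-- The contraction `i_P Q ∈ C^{p+q-1}` of `P ∈ C^p` and `Q ∈ C^q`, for `p = m + 1`,
`q = n + 1`:
`(i_P Q)(x) = ∑_{σ ∈ Sh(p, q-1)} (-1)^σ Q(P(x_{σ(1)}, …), α^{p-1} x_{σ(p+1)}, …)`. -/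
def contraction {m n : ℕ} (P : cochain α (m + 1)) (Q : cochain α (n + 1)) :
    cochain α (m + 1 + n) :=
  ⟨{ toFun := fun x => ∑ σ ∈ shuffles (m + 1) n, (Equiv.Perm.sign σ : ℤ) •
        Q.1 (Fin.cons (P.1 (fun i => x (σ (Fin.castAdd n i))))
          (fun j => (α ^ m) (x (σ (Fin.natAdd (m + 1) j)))))
     map_update_add' := fun x i p q => by
        rename_i inst
        have e : inst = instDecidableEqFin _ := Subsingleton.elim _ _
        subst e
        simp only [← contraction_aux, AlternatingMap.map_update_add]
     map_update_smul' := fun x i c p => by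
        rename_i inst
        have e : inst = instDecidableEqFin _ := Subsingleton.elim _ _
        subst e
        simp only [← contraction_aux, AlternatingMap.map_update_smul]
     map_eq_zero_of_eq' := fun x i j hx hij => by
        simp only [← contraction_aux]
        exact AlternatingMap.map_eq_zero_of_eq _ x hx hij }, by
    intro x
    simp only [AlternatingMap.coe_mk, MultilinearMap.coe_mk, map_sum, map_zsmul]
    refine Finset.sum_congr rfl fun σ _ => ?_
    rw [cochain_map]
    congr 2
    funext i
    refine Fin.cases ?_ (fun j => ?_) i
    · simp [cochain_map]
    · simp [pow_comm_apply]⟩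

end Contraction

section Cup

theorem cup_aux (μ : g →ₗ[k] g →ₗ[k] g) {m n : ℕ} (P : g [⋀^Fin (m + 1)]→ₗ[k] g)
    (Q : g [⋀^Fin (n + 1)]→ₗ[k] g) (x : Fin (m + 1 + (n + 1)) → g) :
    (TensorProduct.lift μ).compAlternatingMap
      ((((α ^ n).compAlternatingMap P).domCoprod
        ((α ^ m).compAlternatingMap Q)).domDomCongr finSumFinEquiv) x =
    ∑ σ ∈ shuffles (m + 1) (n + 1), (Equiv.Perm.sign σ : ℤ) •
      μ ((α ^ n) (P (fun i => x (σ (Fin.castAdd (n + 1) i)))))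
        ((α ^ m) (Q (fun j => x (σ (Fin.natAdd (m + 1) j))))) := by
  rw [LinearMap.compAlternatingMap_apply, domCoprod_eq_sum_shuffles, map_sum]
  refine Finset.sum_congr rfl fun σ _ => ?_
  rw [map_zsmul]
  rfl

/-- The cup product bracket `[P, Q]_C ∈ C^{p+q}` of `P ∈ C^p` and `Q ∈ C^q`, for `p = m + 1`,
`q = n + 1`:
`∑_{σ ∈ Sh(p, q)} (-1)^σ [α^{q-1} P(x_{σ(1)}, …), α^{p-1} Q(x_{σ(p+1)}, …)]`. -/
def cupBracket (h : IsHomLieAlgebra μ α) {m n : ℕ} (P : cochain α (m + 1))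
    (Q : cochain α (n + 1)) : cochain α (m + 1 + (n + 1)) :=
  ⟨{ toFun := fun x => ∑ σ ∈ shuffles (m + 1) (n + 1), (Equiv.Perm.sign σ : ℤ) •
        μ ((α ^ n) (P.1 (fun i => x (σ (Fin.castAdd (n + 1) i)))))
          ((α ^ m) (Q.1 (fun j => x (σ (Fin.natAdd (m + 1) j)))))
     map_update_add' := fun x i p q => by
        rename_i inst
        have e : inst = instDecidableEqFin _ := Subsingleton.elim _ _
        subst e
        simp only [← cup_aux, AlternatingMap.map_update_add]
     map_update_smul' := fun x i c p => by
        rename_i inst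
        have e : inst = instDecidableEqFin _ := Subsingleton.elim _ _
        subst e
        simp only [← cup_aux, AlternatingMap.map_update_smul]
     map_eq_zero_of_eq' := fun x i j hx hij => by
        simp only [← cup_aux]
        exact AlternatingMap.map_eq_zero_of_eq _ x hx hij }, by
    intro x
    simp only [AlternatingMap.coe_mk, MultilinearMap.coe_mk, map_sum, map_zsmul]
    refine Finset.sum_congr rfl fun σ _ => ?_
    rw [h.multiplicative, ← pow_comm_apply, ← pow_comm_apply, cochain_map, cochain_map]⟩

end Cup

section Differential

variable [CharZero k]

/-- Auxiliary: an alternating map whose values are those of the differential. -/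
noncomputable def differentialAlt (μ : g →ₗ[k] g →ₗ[k] g) (α : g →ₗ[k] g) {n : ℕ}
    (f : g [⋀^Fin (n + 1)]→ₗ[k] g) : g [⋀^Fin (n + 2)]→ₗ[k] g :=
  AlternatingMap.alternatizeUncurryFin
      { toFun := fun x => (μ ((α ^ n) x)).compAlternatingMap f
        map_add' := fun x y => by ext; simp
        map_smul' := fun c x => by ext; simp } -
    (2⁻¹ : k) • AlternatingMap.alternatizeUncurryFin
      (AlternatingMap.alternatizeUncurryFinLM ∘ₗ
        LinearMap.mk₂ k (fun x y => (f.curryLeft (μ x y)).compLinearMap α)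
          (fun _ _ _ => by ext; simp) (fun _ _ _ => by ext; simp)
          (fun _ _ _ => by ext; simp) (fun _ _ _ => by ext; simp))

theorem differentialAlt_apply (h : IsHomLieAlgebra μ α) {n : ℕ}
    (f : g [⋀^Fin (n + 1)]→ₗ[k] g) (x : Fin (n + 2) → g) :
    differentialAlt μ α f x =
      ∑ i : Fin (n + 2), (-1 : ℤ) ^ (i : ℕ) • μ ((α ^ n) (x i)) (f (i.removeNth x)) +
      ∑ i : Fin (n + 1), ∑ j ∈ Finset.Ici i, (-1 : ℤ) ^ ((i : ℕ) + (j : ℕ) + 1) •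
        f (Fin.cons (μ (x i.castSucc) (x j.succ))
          (fun l => α (j.removeNth (i.castSucc.removeNth x) l))) := by
  rw [differentialAlt, AlternatingMap.sub_apply, AlternatingMap.smul_apply,
    AlternatingMap.alternatizeUncurryFin_alternatizeUncurryFinLM_comp_apply,
    AlternatingMap.alternatizeUncurryFin_apply, sub_eq_add_neg]
  congr 1
  rw [Finset.smul_sum, ← Finset.sum_neg_distrib]
  refine Finset.sum_congr rfl fun i _ => ?_
  rw [Finset.smul_sum, ← Finset.sum_neg_distrib]
  refine Finset.sum_congr rfl fun j _ => ?_
  rw [LinearMap.mk₂_apply, LinearMap.mk₂_apply, h.skew (x j.succ), map_neg]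
  generalize hA : (f.curryLeft (μ (x i.castSucc) (x j.succ))) = A
  have e : f (Fin.cons (μ (x i.castSucc) (x j.succ))
      (fun l => α (j.removeNth (i.castSucc.removeNth x) l))) =
      A.compLinearMap α (j.removeNth (i.castSucc.removeNth x)) := by
    rw [← hA]; rfl
  have e2 : (-A).compLinearMap α (j.removeNth (i.castSucc.removeNth x)) =
      - A.compLinearMap α (j.removeNth (i.castSucc.removeNth x)) := by simp
  rw [e, e2, sub_neg_eq_add, ← two_smul k, smul_comm, smul_smul, pow_succ, mul_neg_one, neg_smul,
    inv_mul_cancel₀ two_ne_zero, one_smul]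

/-- The differential `δ_Hom : C^{n+1} → C^{n+2}`. With indices starting at `0` the pairs of
positions `p < q` are written `p = i.castSucc`, `q = j.succ` with `i ≤ j`, so `p + q = i + j + 1`;
`j.removeNth (i.castSucc.removeNth x)` is `x` with the entries at `p` and `q` left out. -/
def differential (h : IsHomLieAlgebra μ α) {n : ℕ} (f : cochain α (n + 1)) :
    cochain α (n + 2) :=
  ⟨{ toFun := fun x =>
        ∑ i : Fin (n + 2), (-1 : ℤ) ^ (i : ℕ) • μ ((α ^ n) (x i)) (f.1 (i.removeNth x)) +
        ∑ i : Fin (n + 1), ∑ j ∈ Finset.Ici i, (-1 : ℤ) ^ ((i : ℕ) + (j : ℕ) + 1) •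
          f.1 (Fin.cons (μ (x i.castSucc) (x j.succ))
            (fun l => α (j.removeNth (i.castSucc.removeNth x) l)))
     map_update_add' := fun x i p q => by
        rename_i inst
        have e : inst = instDecidableEqFin _ := Subsingleton.elim _ _
        subst e
        simp only [← differentialAlt_apply h, AlternatingMap.map_update_add]
     map_update_smul' := fun x i c p => by
        rename_i inst
        have e : inst = instDecidableEqFin _ := Subsingleton.elim _ _
        subst e
        simp only [← differentialAlt_apply h, AlternatingMap.map_update_smul]
     map_eq_zero_of_eq' := fun x i j hx hij => by
        simp only [← differentialAlt_apply h]
        exact AlternatingMap.map_eq_zero_of_eq _ x hx hij }, by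
    intro x
    simp only [AlternatingMap.coe_mk, MultilinearMap.coe_mk, map_add, map_sum, map_zsmul]
    congr 1
    · refine Finset.sum_congr rfl fun i _ => ?_
      rw [h.multiplicative, ← pow_comm_apply, cochain_map]
      rfl
    · refine Finset.sum_congr rfl fun i _ => Finset.sum_congr rfl fun j _ => ?_
      rw [cochain_map, ← h.multiplicative]
      congr 2
      funext l
      refine Fin.cases ?_ (fun l => ?_) l
      · simp
      · simp [Fin.removeNth_apply]⟩

/-- The Frölicher–Nijenhuis bracket
`[P, Q]_FN = [P, Q]_C + (-1)^p i_{δP} Q - (-1)^{(p+1) q} i_{δQ} P ∈ C^{p+q}`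
of `P ∈ C^p` and `Q ∈ C^q`, for `p = m + 1`, `q = n + 1`. -/
def fnBracket (h : IsHomLieAlgebra μ α) {m n : ℕ} (P : cochain α (m + 1))
    (Q : cochain α (n + 1)) : cochain α (m + 1 + (n + 1)) :=
  cupBracket h P Q
    + (-1 : ℤ) ^ (m + 1) •
      cochain.cast (show m + 1 + 1 + n = m + 1 + (n + 1) by omega)
        (contraction (differential h P) Q)
    - (-1 : ℤ) ^ ((m + 1 + 1) * (n + 1)) •
      cochain.cast (show n + 1 + 1 + m = m + 1 + (n + 1) by omega)
        (contraction (differential h Q) P)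

/-- Maurer–Cartan elements `s` of the Frölicher–Nijenhuis algebra `(C^•_Hom(g, g), [ , ]_FN)`,
with zero differential: `s` has degree `1` and `½ [s, s]_FN = 0`. -/
def IsMaurerCartan (h : IsHomLieAlgebra μ α) (s : cochain α 1) : Prop :=
  (2⁻¹ : k) • fnBracket (m := 0) (n := 0) h s s = 0

end Differential

/-- The deformed bracket `[x, y]^N = [N x, y] + [x, N y] - N [x, y]`. -/
def deformedBracket (μ : g →ₗ[k] g →ₗ[k] g) (N : g →ₗ[k] g) : g →ₗ[k] g →ₗ[k] g :=
  LinearMap.mk₂ k (fun x y => μ (N x) y + μ x (N y) - N (μ x y))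
    (fun _ _ _ => by simp only [map_add, LinearMap.add_apply]; abel)
    (fun _ _ _ => by simp [smul_add, smul_sub])
    (fun _ _ _ => by simp only [map_add]; abel)
    (fun _ _ _ => by simp [smul_add, smul_sub])

/-- Nijenhuis operators on the Hom-Lie algebra `(g, μ, α)`. -/
structure IsNijenhuis (μ : g →ₗ[k] g →ₗ[k] g) (α N : g →ₗ[k] g) : Prop where
  comm : α ∘ₗ N = N ∘ₗ α
  nijenhuis : ∀ x y, μ (N x) (N y) = N (deformedBracket μ N x y)

end HomLie

/-!
Everything reduces to low-degree evaluations. For `N` commuting with `α`, the differential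
`δN` is the deformed bracket `[ , ]^N` (`differential_ofLinear_apply`); since `Sh(1, 1)` has two
elements and `Sh(2, 0)` has one, `[N, N]_FN = 2 T` with `T(x, y) = [N x, N y] - N [x, y]^N` the
Nijenhuis torsion (`fnBracket_ofLinear_apply`). As `2` is invertible, `[N, N]_FN` vanishes exactly
when `N` is Nijenhuis, and every element of `C^1` comes from a linear map, which gives the
Maurer–Cartan description.

The deformed bracket is always skew-symmetric and preserved by `α`, so it is Hom-Lie exactly when
its Hom-Jacobiator vanishes. That Jacobiator is `-½ δ[N, N]_FN`, by expanding both sides and using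
the Hom-Jacobi identity of `[ , ]` at the triples obtained from `(x, y, z)` by applying `N` to
none, one or two of the entries (`differential_fnBracket_ofLinear_apply`).
-/

namespace HomLie

theorem shuffles_one_one : shuffles 1 1 = {1, Equiv.swap 0 1} := by
  decide

theorem shuffles_two_zero : shuffles 2 0 = {1} := by
  decide

variable {k g : Type*} [Field k] [AddCommGroup g] [Module k g]
  {α : g →ₗ[k] g} {μ : g →ₗ[k] g →ₗ[k] g}

theorem deformedBracket_apply (N : g →ₗ[k] g) (x y : g) :
    deformedBracket μ N x y = μ (N x) y + μ x (N y) - N (μ x y) := rfl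

theorem exists_eq_ofLinear (s : cochain α 1) :
    ∃ (N : g →ₗ[k] g) (hN : α ∘ₗ N = N ∘ₗ α), s = ofLinear N hN := by
  let N := (AlternatingMap.ofSubsingleton k g g (0 : Fin 1)).symm s.1
  have hs (x : Fin 1 → g) : s.1 x = N (x 0) := by
    change s.1 x = s.1 (fun _ => x 0)
    congr 1
    ext i
    rw [Subsingleton.elim i 0]
  refine ⟨N, ?_, ?_⟩
  · ext x
    have := s.2 (fun _ => x)
    rwa [hs, hs] at this
  · ext x
    exact hs x

theorem cupBracket_ofLinear_apply (h : IsHomLieAlgebra μ α) (N : g →ₗ[k] g)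
    (hN : α ∘ₗ N = N ∘ₗ α) (x : Fin 2 → g) :
    (cupBracket (m := 0) (n := 0) h (ofLinear N hN) (ofLinear N hN)).1 x =
      (2 : k) • μ (N (x 0)) (N (x 1)) := by
  change ∑ σ ∈ shuffles 1 1, (Equiv.Perm.sign σ : ℤ) •
    μ (N (x (σ 0))) (N (x (σ 1))) = _
  rw [shuffles_one_one, Finset.sum_pair (by decide)]
  simp [h.skew (N (x 1)), two_smul]

theorem contraction_ofLinear_apply (P : cochain α 2) (N : g →ₗ[k] g)
    (hN : α ∘ₗ N = N ∘ₗ α) (x : Fin 2 → g) :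
    (contraction (m := 1) (n := 0) P (ofLinear N hN)).1 x = N (P.1 x) := by
  change ∑ σ ∈ shuffles 2 0, (Equiv.Perm.sign σ : ℤ) • N (P.1 fun i => x (σ i)) = _
  simp [shuffles_two_zero]

section CharZero

variable [CharZero k]

theorem differential_ofLinear_apply (h : IsHomLieAlgebra μ α) (N : g →ₗ[k] g)
    (hN : α ∘ₗ N = N ∘ₗ α) (x : Fin 2 → g) :
    (differential (n := 0) h (ofLinear N hN)).1 x = deformedBracket μ N (x 0) (x 1) := by
  change ∑ i : Fin 2, (-1 : ℤ) ^ (i : ℕ) • μ (x i) (N (i.removeNth x 0)) +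
    ∑ i : Fin 1, ∑ j ∈ Finset.Ici i, (-1 : ℤ) ^ ((i : ℕ) + (j : ℕ) + 1) •
      N (μ (x i.castSucc) (x j.succ)) = _
  have h0 : Finset.Ici (0 : Fin 1) = {0} := by decide
  simp [Fin.sum_univ_two, h0, Fin.removeNth_apply, deformedBracket_apply, h.skew (x 1)]
  abel

/-- `[N, N]_FN` is twice the Nijenhuis torsion of `N`. -/
theorem fnBracket_ofLinear_apply (h : IsHomLieAlgebra μ α) (N : g →ₗ[k] g)
    (hN : α ∘ₗ N = N ∘ₗ α) (x : Fin 2 → g) :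
    (fnBracket (m := 0) (n := 0) h (ofLinear N hN) (ofLinear N hN)).1 x =
      (2 : k) • (μ (N (x 0)) (N (x 1)) - N (deformedBracket μ N (x 0) (x 1))) := by
  -- The degrees involved all reduce to `2`, so both `cochain.cast`s are definitionally trivial.
  change (cupBracket (m := 0) (n := 0) h (ofLinear N hN) (ofLinear N hN)).1 x
    + (-1 : ℤ) ^ 1 • (contraction (m := 1) (n := 0) (differential (n := 0) h (ofLinear N hN))
        (ofLinear N hN)).1 x
    - (-1 : ℤ) ^ 2 • (contraction (m := 1) (n := 0) (differential (n := 0) h (ofLinear N hN))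
        (ofLinear N hN)).1 x = _
  rw [cupBracket_ofLinear_apply, contraction_ofLinear_apply, differential_ofLinear_apply,
    smul_sub, two_smul k (N _)]
  simp only [pow_one, neg_smul, one_smul, even_two, Even.neg_pow, one_pow]
  abel

theorem fnBracket_ofLinear_eq_zero_iff (h : IsHomLieAlgebra μ α) (N : g →ₗ[k] g)
    (hN : α ∘ₗ N = N ∘ₗ α) :
    fnBracket (m := 0) (n := 0) h (ofLinear N hN) (ofLinear N hN) = 0 ↔
      IsNijenhuis μ α N := by
  constructor
  · intro h0
    refine ⟨hN, fun x y => ?_⟩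
    have := fnBracket_ofLinear_apply h N hN ![x, y]
    rw [h0] at this
    exact sub_eq_zero.1 ((smul_eq_zero.1 this.symm).resolve_left two_ne_zero)
  · intro hNij
    ext x
    refine (fnBracket_ofLinear_apply h N hN x).trans ?_
    rw [hNij.nijenhuis, sub_self, smul_zero]
    rfl

theorem isMaurerCartan_ofLinear_iff (h : IsHomLieAlgebra μ α) (N : g →ₗ[k] g)
    (hN : α ∘ₗ N = N ∘ₗ α) :
    IsMaurerCartan h (ofLinear N hN) ↔ IsNijenhuis μ α N := by
  rw [← fnBracket_ofLinear_eq_zero_iff h N hN, IsMaurerCartan,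
    smul_eq_zero_iff_right (inv_ne_zero two_ne_zero)]

theorem differential_two_apply (h : IsHomLieAlgebra μ α) (f : cochain α 2) (x : Fin 3 → g) :
    (differential (n := 1) h f).1 x =
      μ (α (x 0)) (f.1 ![x 1, x 2]) - μ (α (x 1)) (f.1 ![x 0, x 2])
        + μ (α (x 2)) (f.1 ![x 0, x 1])
      - f.1 ![μ (x 0) (x 1), α (x 2)] + f.1 ![μ (x 0) (x 2), α (x 1)]
        - f.1 ![μ (x 1) (x 2), α (x 0)] := by
  have e0 : (0 : Fin 3).removeNth x = ![x 1, x 2] := by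
    ext i; fin_cases i <;> rfl
  have e1 : (1 : Fin 3).removeNth x = ![x 0, x 2] := by
    ext i; fin_cases i <;> rfl
  have e2 : (2 : Fin 3).removeNth x = ![x 0, x 1] := by
    ext i; fin_cases i <;> rfl
  have c (p : g) (y : Fin 1 → g) : (Fin.cons p (fun l => α (y l)) : Fin 2 → g) =
      ![p, α (y 0)] := by
    ext i; fin_cases i <;> rfl
  have h0 : Finset.Ici (0 : Fin 2) = {0, 1} := by decide
  have h1 : Finset.Ici (1 : Fin 2) = {1} := by decide
  change ∑ i : Fin 3, (-1 : ℤ) ^ (i : ℕ) • μ ((α ^ 1) (x i)) (f.1 (i.removeNth x)) +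
    ∑ i : Fin 2, ∑ j ∈ Finset.Ici i, (-1 : ℤ) ^ ((i : ℕ) + (j : ℕ) + 1) •
      f.1 (Fin.cons (μ (x i.castSucc) (x j.succ))
        (fun l => α (j.removeNth (i.castSucc.removeNth x) l))) = _
  simp only [c, Fin.sum_univ_three, Fin.sum_univ_two, h0, h1,
    Finset.sum_pair (show (0 : Fin 2) ≠ 1 by decide), Finset.sum_singleton]
  simp [e0, e1, e2, Fin.removeNth_apply]
  abel

/-- `δ[N, N]_FN` is `-2` times the Hom-Jacobiator of the deformed bracket. -/
theorem differential_fnBracket_ofLinear_apply (h : IsHomLieAlgebra μ α) (N : g →ₗ[k] g)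
    (hN : α ∘ₗ N = N ∘ₗ α) (x : Fin 3 → g) :
    (differential (n := 1) h
      (fnBracket (m := 0) (n := 0) h (ofLinear N hN) (ofLinear N hN))).1 x =
      -(2 : k) • (deformedBracket μ N (α (x 0)) (deformedBracket μ N (x 1) (x 2))
        + deformedBracket μ N (α (x 1)) (deformedBracket μ N (x 2) (x 0))
        + deformedBracket μ N (α (x 2)) (deformedBracket μ N (x 0) (x 1))) := by
  have hc (a : g) : N (α a) = α (N a) := (LinearMap.congr_fun hN a).symm
  let B : cochain α 2 := fnBracket (m := 0) (n := 0) h (ofLinear N hN) (ofLinear N hN)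
  have hB (a b : g) : B.1 ![a, b] = (2 : k) • (μ (N a) (N b) - N (deformedBracket μ N a b)) :=
    fnBracket_ofLinear_apply h N hN ![a, b]
  change (differential (n := 1) h B).1 x = _
  rw [differential_two_apply]
  simp only [hB]
  generalize x 0 = a, x 1 = b, x 2 = c
  have j0 := congrArg (fun t => N (N t)) (h.hom_jacobi a b c)
  have j1 := congrArg N (h.hom_jacobi (N a) b c)
  have j2 := congrArg N (h.hom_jacobi a (N b) c)
  have j3 := congrArg N (h.hom_jacobi a b (N c))
  have j4 := h.hom_jacobi a (N b) (N c)
  have j5 := h.hom_jacobi (N a) b (N c)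
  have j6 := h.hom_jacobi (N a) (N b) c
  -- Normal form: `N` inside `α`, `α _` to the left of inner brackets, `a` to the left of `c`.
  simp only [deformedBracket_apply, hc, map_add, map_sub, map_zero, map_neg, map_smul,
    h.skew (μ _ _) (α _), h.skew (N (μ _ _)) (α _),
    h.skew c a, h.skew (N c) a, h.skew c (N a), h.skew (N c) (N a)] at j0 j1 j2 j3 j4 j5 j6 ⊢
  linear_combination (norm := module) (2 : k) • (j0 - j1 - j2 - j3 + j4 + j5 + j6)

/-- Skew-symmetry and multiplicativity of the deformed bracket are automatic, so only the
Hom-Jacobi identity is at stake. -/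
theorem isHomLieAlgebra_deformedBracket_iff (h : IsHomLieAlgebra μ α) (N : g →ₗ[k] g)
    (hN : α ∘ₗ N = N ∘ₗ α) :
    IsHomLieAlgebra (deformedBracket μ N) α ↔
      differential (n := 1) h
        (fnBracket (m := 0) (n := 0) h (ofLinear N hN) (ofLinear N hN)) = 0 := by
  have hc (a : g) : α (N a) = N (α a) := LinearMap.congr_fun hN a
  constructor
  · intro hD
    ext x
    refine (differential_fnBracket_ofLinear_apply h N hN x).trans ?_
    rw [hD.hom_jacobi, smul_zero]
    rfl
  · intro h0
    refine ⟨fun x y => ?_, fun x y z => ?_, fun x y => ?_⟩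
    · simp only [deformedBracket_apply]
      rw [h.skew (N x) y, h.skew x (N y), h.skew x y, map_neg]
      abel
    · have := differential_fnBracket_ofLinear_apply h N hN ![x, y, z]
      rw [h0] at this
      exact (smul_eq_zero.1 this.symm).resolve_left (neg_ne_zero.2 two_ne_zero)
    · simp only [deformedBracket_apply, map_sub, map_add, h.multiplicative, hc]

end CharZero

end HomLie

theorem mainTheorem6 {k : Type*} [Field k] [CharZero k] {g : Type*} [AddCommGroup g] [Module k g]
    (μ : g →ₗ[k] g →ₗ[k] g) (α : g →ₗ[k] g) (h : IsHomLieAlgebra μ α) :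
    (∀ (N : g →ₗ[k] g) (hN : α ∘ₗ N = N ∘ₗ α),
      (IsHomLieAlgebra (HomLie.deformedBracket μ N) α ↔
        HomLie.differential h
          (HomLie.fnBracket h (HomLie.ofLinear N hN) (HomLie.ofLinear N hN)) = 0) ∧
      (∀ x y : g,
        (HomLie.fnBracket h (HomLie.ofLinear N hN) (HomLie.ofLinear N hN)).1 ![x, y] =
          (2 : k) • (μ (N x) (N y) - N (HomLie.deformedBracket μ N x y))) ∧
      (HomLie.IsNijenhuis μ α N ↔
        HomLie.fnBracket h (HomLie.ofLinear N hN) (HomLie.ofLinear N hN) = 0)) ∧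
    (∀ N : g →ₗ[k] g, HomLie.IsNijenhuis μ α N ↔
      ∃ hN : α ∘ₗ N = N ∘ₗ α, HomLie.IsMaurerCartan h (HomLie.ofLinear N hN)) ∧
    (∀ s : HomLie.cochain α 1, HomLie.IsMaurerCartan h s ↔
      ∃ (N : g →ₗ[k] g) (hN : α ∘ₗ N = N ∘ₗ α),
        HomLie.IsNijenhuis μ α N ∧ s = HomLie.ofLinear N hN) := by
  refine ⟨fun N hN => ⟨HomLie.isHomLieAlgebra_deformedBracket_iff h N hN,
    fun x y => HomLie.fnBracket_ofLinear_apply h N hN ![x, y],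
    (HomLie.fnBracket_ofLinear_eq_zero_iff h N hN).symm⟩, fun N => ?_, fun s => ?_⟩
  · exact ⟨fun hNij => ⟨hNij.comm, (HomLie.isMaurerCartan_ofLinear_iff h N hNij.comm).2 hNij⟩,
      fun ⟨hN, hs⟩ => (HomLie.isMaurerCartan_ofLinear_iff h N hN).1 hs⟩
  · constructor
    · intro hs
      obtain ⟨N, hN, rfl⟩ := HomLie.exists_eq_ofLinear s
      exact ⟨N, hN, (HomLie.isMaurerCartan_ofLinear_iff h N hN).1 hs, rfl⟩
    · rintro ⟨N, hN, hNij, rfl⟩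
      exact (HomLie.isMaurerCartan_ofLinear_iff h N hN).2 hNij
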